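/- Let $\mathbb K=\mathbb R$ or $\mathbb C$. Let $X$ be an infinite-dimensional Fréchet space over $\mathbb K$ that carries a continuous norm, let $Y$ be a separable Fréchet space over $\mathbb K$, and let $(T_n)_{n\ge1}$ be a sequence of continuous linear operators from $X$ to $Y$. Let $(p_n)_{n\ge1}$ and $(q_n)_{n\ge1}$ be sequences of seminorms defining the topologies of $X$ and $Y$ respectively. Suppose that: (1) $(T_n)$ satisfies condition (C) for a (strictly) increasing sequence $(n_k)_{k\ge1}$ of positive integers, that is, there is a dense subset $X_0\subset X$ with $T_{n_k}x\to0$ as $k\to\infty$ for every $x\in X_0$, and for every continuous seminorm $r$ on $X$ the set $\bigcup_{k\ge1}T_{n_k}(\{x\in X: r(x)<1\})$ is dense in $Y$; (2) there is a non-increasing sequence $M_1\supset M_2\supset\cdots$ of infinite-dimensional closed subspaces of $X$ such that for every $n\ge1$ there exist a real number $C_n>0$ and integers $m(n),k(n)\ge1$ with $$q_n(T_{n_j}x)\le C_n\,p_{m(n)}(x)\qquad\text{for all } j\ge k(n)\text{ and all }x\in M_j.$$ Then $(T_n)$ has a hypercyclic subspace: there is an infinite-dimensional closed subspace $M$ of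 $X$ such that for every nonzero $x\in M$ the set $\{T_nx:n\ge1\}$ is dense in $Y$. -/

import Mathlib

open Filter Topology

section HypercyclicSubspaces

variable {𝕜 : Type*} [RCLike 𝕜]
  {X : Type*} [AddCommGroup X] [Module 𝕜 X] [TopologicalSpace X]
  {Y : Type*} [AddCommGroup Y] [Module 𝕜 Y] [TopologicalSpace Y]

/-- The topological vector space `X` carries a continuous norm, i.e. a continuous seminorm
that vanishes only at `0`. -/
def HasContinuousNorm (𝕜 : Type*) [RCLike 𝕜] (X : Type*) [AddCommGroup X] [Module 𝕜 X]
    [TopologicalSpace X] : Prop :=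
  ∃ r : Seminorm 𝕜 X, Continuous r ∧ ∀ x : X, r x = 0 → x = 0

/-- The sequence of operators `T` satisfies condition (C) for the increasing sequence of
indices `(n k)`. All sequences are indexed from `0`. -/
def SatisfiesConditionC (T : ℕ → X →L[𝕜] Y) (n : ℕ → ℕ) : Prop :=
  StrictMono n ∧
    ∃ X₀ : Set X, Dense X₀ ∧
      (∀ x ∈ X₀, Tendsto (fun k => T (n k) x) atTop (𝓝 0)) ∧
      ∀ r : Seminorm 𝕜 X, Continuous r →
        Dense (⋃ k, (fun x => T (n k) x) '' {x : X | r x < 1})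

/-- The vector `x` is hypercyclic for the sequence `T`: the set of all `T n x` is dense. -/
def IsHypercyclicVector (T : ℕ → X →L[𝕜] Y) (x : X) : Prop :=
  Dense (Set.range fun n => T n x)

/-- The sequence `T` has a hypercyclic subspace: an infinite-dimensional closed subspace in
which every nonzero vector is hypercyclic for `T`. -/
def HasHypercyclicSubspace (T : ℕ → X →L[𝕜] Y) : Prop :=
  ∃ M : Submodule 𝕜 X, IsClosed (M : Set X) ∧ ¬ FiniteDimensional 𝕜 M ∧
    ∀ x ∈ M, x ≠ 0 → IsHypercyclicVector T x

end HypercyclicSubspaces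

namespace HypercyclicSubspace

section

/-! Condition (C) makes hypercyclic vectors out of small summands; the bounds on the subspaces M_j
allow this to be done simultaneously along a whole basic sequence. Write S_j for T_{n_j}, and
replace the seminorms by increasing families `P` (all norms) and `Q`.

Mazur's method gives a basic sequence u_j ∈ M_j with coordinate functionals dominated by `P 0`
(`exists_normalized_basic_sequence`). Approximate u_j by v_j ∈ X₀. Condition (C) then yields
increasing indices J(s) and tiny x_s ∈ X₀ with S_{J(s)} x_s close to a target y_s and all cross
terms negligible (`exists_perturbation_sequence`). Let e_s = u_{J(s)}, with coordinates ψ_s, let U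
be the closed span of the e_s, and put K z = ∑ (ψ_s(z) (v_{J(s)} - e_s) + ψ_{κ(s)}(z) x_s), where
every pair (coordinate κ(s), target y_s) recurs infinitely often. As K is small, I + K is injective
on U with closed image (`isClosed_map_id_add`); this image is the required subspace.

If w ∈ U, ψ_k(w) ≠ 0 and κ(s) = k, then S_{J(s)}(w + K w) differs from ψ_k(w) y_s by S_{J(s)} of the
s-th tail of w, up to o(1) (`seminorm_perturbed_sub_le`). That tail lies in M_{J(s)} and tends to 0,
so the uniform bound there makes its image tend to 0. -/

theorem exists_seq_of_forall_history {α : Type*} (R : ∀ s : ℕ, (Fin s → α) → α → Prop)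
    (h : ∀ s g, ∃ a, R s g a) : ∃ f : ℕ → α, ∀ s, R s (fun i : Fin s => f i) (f s) := by
  choose c hc using h
  let f : ℕ → α := fun s =>
    Nat.strongRec (motive := fun _ => α) (fun s ih => c s fun i : Fin s => ih i i.2) s
  refine ⟨f, fun s => ?_⟩
  have hf : f s = c s fun i : Fin s => f i := by
    simp only [f]
    rw [Nat.strongRec]
  rw [hf]
  exact hc _ _

/-! ### Norming functionals and common kernels -/

section Dual

variable {𝕜 : Type*} [RCLike 𝕜] {E : Type*} [AddCommGroup E] [Module 𝕜 E]

theorem exists_dual_le_seminorm (r : Seminorm 𝕜 E) (x : E) :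
    ∃ f : Module.Dual 𝕜 E, (∀ y, ‖f y‖ ≤ r y) ∧ f x = (r x : 𝕜) := by
  by_cases hx : x = 0
  · exact ⟨0, by simp [hx]⟩
  obtain ⟨f, hf, hle⟩ := Module.Dual.exists_extension_of_le_seminorm (𝕜 := 𝕜)
    (Submodule.span 𝕜 {x}) ((r x : 𝕜) • (LinearEquiv.coord 𝕜 E x hx).toLinearMap)
    (p := r) (by
      intro y
      have hy : LinearEquiv.coord 𝕜 E x hx y • x = y := LinearEquiv.coord_apply_smul 𝕜 E x hx y
      conv_rhs => rw [← hy, map_smul_eq_mul]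
      simp [RCLike.real_smul_eq_coe_mul, abs_of_nonneg, mul_comm])
  refine ⟨f, hle, ?_⟩
  have := hf ⟨x, Submodule.mem_span_singleton_self x⟩
  simp only at this
  rw [this]
  simp [LinearEquiv.coord_self, RCLike.real_smul_eq_coe_mul]

/-- By compactness of the unit sphere of `F`, finitely many Hahn–Banach functionals recover at least
half of `r x` for every x in `F`; adding a vector that they all kill does not change their values.
This is the Mazur step. -/
theorem exists_finset_dual_norming [TopologicalSpace E] [IsTopologicalAddGroup E]
    [ContinuousSMul 𝕜 E] (r : Seminorm 𝕜 E) (hr : Continuous r)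
    (hr0 : ∀ x, r x = 0 → x = 0) (F : Submodule 𝕜 E) [FiniteDimensional 𝕜 F] :
    ∃ s : Finset (Module.Dual 𝕜 E),
      ∀ x ∈ F, ∀ y, (∀ f ∈ s, f y = 0) → r x ≤ 2 * r (x + y) := by
  classical
  let b := Module.finBasis 𝕜 F
  let e : (Fin (Module.finrank 𝕜 F) → 𝕜) →ₗ[𝕜] E := F.subtype ∘ₗ b.equivFun.symm.toLinearMap
  have he : Continuous e := LinearMap.continuous_of_finiteDimensional e
  have einj : ∀ a, e a = 0 → a = 0 := fun a ha => by
    have : Function.Injective e :=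
      (Subtype.val_injective).comp b.equivFun.symm.injective
    exact this (by simpa using ha)
  choose ψ hψ hψ' using fun x => exists_dual_le_seminorm r x
  have hcov : Metric.sphere (0 : Fin (Module.finrank 𝕜 F) → 𝕜) 1 ⊆
      ⋃ a : Metric.sphere (0 : Fin (Module.finrank 𝕜 F) → 𝕜) 1,
        {c | r (e c) < 2 * ‖ψ (e a) (e c)‖} := by
    intro a ha
    refine Set.mem_iUnion.2 ⟨⟨a, ha⟩, ?_⟩
    have hne : r (e a) ≠ 0 := fun h => by
      have := einj a (hr0 _ h)
      simp [this] at ha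
    have hpos : 0 < r (e a) := lt_of_le_of_ne (apply_nonneg r _) hne.symm
    simp only [Set.mem_ofPred_eq, hψ', RCLike.norm_ofReal, abs_of_pos hpos]
    linarith
  obtain ⟨t, ht⟩ := (isCompact_sphere _ _).elim_finite_subcover _ (fun a => by
    have h1 : Continuous ((ψ (e a)) ∘ₗ e) := LinearMap.continuous_of_finiteDimensional _
    exact isOpen_lt (hr.comp he) (continuous_const.mul h1.norm)) hcov
  refine ⟨t.image fun a : Metric.sphere (0 : Fin (Module.finrank 𝕜 F) → 𝕜) 1 => ψ (e a), fun x hx y hy => ?_⟩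
  by_cases hx0 : x = 0
  · simp only [hx0, map_zero]
    positivity
  obtain ⟨c, rfl⟩ : ∃ c, e c = x := ⟨b.equivFun ⟨x, hx⟩, by simp [e]⟩
  have hc0 : c ≠ 0 := by rintro rfl; simp at hx0
  have hcn : ‖c‖ ≠ 0 := norm_ne_zero_iff.2 hc0
  have hmem : ((‖c‖ : 𝕜)⁻¹ • c) ∈ Metric.sphere (0 : Fin (Module.finrank 𝕜 F) → 𝕜) 1 := by
    simp [norm_smul, hcn]
  obtain ⟨a, hat, hlt⟩ := Set.mem_iUnion₂.1 (ht hmem)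
  simp only [Set.mem_ofPred_eq, map_smul, map_smul_eq_mul, norm_smul, norm_inv,
    RCLike.norm_ofReal, abs_norm] at hlt
  have hlt' : r (e c) < 2 * ‖ψ (e a) (e c)‖ := by
    have h0 : 0 < ‖c‖⁻¹ := by positivity
    refine lt_of_mul_lt_mul_left ?_ h0.le
    linarith
  have hya : ψ (e a) y = 0 := hy _ (Finset.mem_image.2 ⟨a, hat, rfl⟩)
  calc r (e c) ≤ 2 * ‖ψ (e a) (e c + y)‖ := by rw [map_add, hya, add_zero]; exact hlt'.le
    _ ≤ 2 * r (e c + y) := by gcongr; exact hψ _ _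

theorem exists_ne_zero_mem_forall_dual_eq_zero (M : Submodule 𝕜 E) (hM : ¬ FiniteDimensional 𝕜 M)
    (s : Finset (Module.Dual 𝕜 E)) : ∃ x ∈ M, x ≠ 0 ∧ ∀ f ∈ s, f x = 0 := by
  by_contra! hcon
  apply hM
  let L : M →ₗ[𝕜] (s → 𝕜) := LinearMap.pi fun f => f.1 ∘ₗ M.subtype
  refine FiniteDimensional.of_injective L ?_
  rw [← LinearMap.ker_eq_bot, LinearMap.ker_eq_bot']
  intro x hx
  by_contra hne
  obtain ⟨f, hf, hfx⟩ := hcon x x.2 (by simpa using hne)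
  exact hfx (congrFun hx ⟨f, hf⟩)

end Dual

end

/-! ### Basic sequences with biorthogonal functionals -/

section

variable {𝕜 : Type*} [RCLike 𝕜] {E : Type*} [AddCommGroup E] [Module 𝕜 E]

theorem exists_basic_sequence [TopologicalSpace E] [IsTopologicalAddGroup E] [ContinuousSMul 𝕜 E]
    {P : ℕ → Seminorm 𝕜 E} (hPc : ∀ n, Continuous (P n))
    (hP0 : ∀ n x, P n x = 0 → x = 0) {M : ℕ → Submodule 𝕜 E}
    (hM : ∀ j, ¬ FiniteDimensional 𝕜 (M j)) :
    ∃ u : ℕ → E, (∀ j, u j ∈ M j) ∧ (∀ j, u j ≠ 0) ∧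
      (∀ i, ∃ f : Module.Dual 𝕜 E, (∀ x, ‖f x‖ ≤ P 0 x) ∧ f (u i) = (P 0 (u i) : 𝕜) ∧
        ∀ j, i < j → f (u j) = 0) ∧
      ∀ n t, n ≤ t → ∀ x ∈ Submodule.span 𝕜 (u '' Set.Iio t),
        ∀ y ∈ Submodule.span 𝕜 (u '' Set.Ici t), P n x ≤ 2 * P n (x + y) := by
  classical
  have hN : ∀ (n : ℕ) (A : Finset E), ∃ s : Finset (Module.Dual 𝕜 E),
      ∀ x ∈ Submodule.span 𝕜 (A : Set E), ∀ y, (∀ f ∈ s, f y = 0) → P n x ≤ 2 * P n (x + y) :=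
    fun n A => by
      have := FiniteDimensional.span_finset 𝕜 A
      exact exists_finset_dual_norming (P n) (hPc n) (hP0 n) _
  choose N hN using hN
  choose χ hχ hχ' using fun x => exists_dual_le_seminorm (P 0) x
  -- Stage t norms the span of the first t vectors for `P 0`, …, `P t`, whence the restriction `n ≤
  -- t` in the basis inequality. The functionals `χ` are added to make the system triangular.
  let G : ∀ t : ℕ, (Fin t → E) → Finset (Module.Dual 𝕜 E) := fun t g =>
    ((Finset.range (t + 1)).biUnion fun n => N n (Finset.univ.image g)) ∪
      Finset.univ.image fun i => χ (g i)
  obtain ⟨u, hu⟩ := exists_seq_of_forall_history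
    (fun s (g : Fin s → E) (a : E) => a ∈ M s ∧ a ≠ 0 ∧ ∀ t : Fin (s + 1),
      ∀ f ∈ G t (fun i => g ⟨i, by omega⟩), f a = 0) (fun s g => by
      obtain ⟨x, hxM, hx0, hx⟩ := exists_ne_zero_mem_forall_dual_eq_zero (M s) (hM s)
        (Finset.univ.biUnion fun t : Fin (s + 1) => G t (fun i => g ⟨i, by omega⟩))
      exact ⟨x, hxM, hx0, fun t f hf => hx f (Finset.mem_biUnion.2 ⟨t, Finset.mem_univ _, hf⟩)⟩)
  have hG : ∀ t s, t ≤ s → ∀ f ∈ G t (fun i => u i), f (u s) = 0 := fun t s hts f hf =>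
    (hu s).2.2 ⟨t, by omega⟩ f hf
  refine ⟨u, fun j => (hu j).1, fun j => (hu j).2.1, fun i => ⟨χ (u i), hχ _, hχ' _,
    fun j hij => hG (i + 1) j hij _ ?_⟩, fun n t hnt x hx y hy => ?_⟩
  · exact Finset.mem_union_right _ (Finset.mem_image.2 ⟨⟨i, by omega⟩, Finset.mem_univ _, rfl⟩)
  · refine hN n (Finset.univ.image fun i : Fin t => u i) x ?_ y fun f hf => ?_
    · convert hx
      ext z
      constructor
      · intro hz
        obtain ⟨i, -, rfl⟩ := Finset.mem_image.1 (Finset.mem_coe.1 hz)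
        exact ⟨i, i.2, rfl⟩
      · rintro ⟨i, hi, rfl⟩
        exact Finset.mem_coe.2 (Finset.mem_image.2 ⟨⟨i, hi⟩, Finset.mem_univ _, rfl⟩)
    · have : Submodule.span 𝕜 (u '' Set.Ici t) ≤ LinearMap.ker f := by
        rw [Submodule.span_le]
        rintro _ ⟨s, hs, rfl⟩
        exact hG t s hs f (Finset.mem_union_left _
          (Finset.mem_biUnion.2 ⟨n, Finset.mem_range.2 (by omega), hf⟩))
      exact this hy

/-- The given functionals are triangular on `u`: the s-th kills all later vectors. Subtracting the
earlier biorthogonal functionals removes its values on the earlier vectors. -/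
theorem exists_biorthogonal {r : Seminorm 𝕜 E} (hr : ∀ x, r x = 0 → x = 0) {u : ℕ → E}
    (hu0 : ∀ j, u j ≠ 0)
    (hu : ∀ i, ∃ f : Module.Dual 𝕜 E, (∀ x, ‖f x‖ ≤ r x) ∧ f (u i) = (r (u i) : 𝕜) ∧
        ∀ j, i < j → f (u j) = 0) (s : ℕ) :
    ∃ f : Module.Dual 𝕜 E, (∃ C : ℝ, 0 < C ∧ ∀ x, ‖f x‖ ≤ C * r x) ∧
      ∀ j, f (u j) = if s = j then 1 else 0 := by
  induction s using Nat.strong_induction_on with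
  | _ s ih =>
  choose! φ hφ hφu using ih
  choose! C hC hφC using hφ
  obtain ⟨f, hf, hfs, hfj⟩ := hu s
  have hrs : r (u s) ≠ 0 := fun h => hu0 s (hr _ h)
  have hrs' : 0 ≤ (r (u s))⁻¹ := inv_nonneg.2 (apply_nonneg r _)
  let g : Module.Dual 𝕜 E := f - ∑ i ∈ Finset.range s, f (u i) • φ i
  refine ⟨(r (u s) : 𝕜)⁻¹ • g, ⟨(r (u s))⁻¹ * (1 + ∑ i ∈ Finset.range s, ‖f (u i)‖ * C i),
    ?_, fun x => ?_⟩, fun j => ?_⟩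
  · have : 0 ≤ ∑ i ∈ Finset.range s, ‖f (u i)‖ * C i :=
      Finset.sum_nonneg fun i hi => mul_nonneg (norm_nonneg _) (hC i (Finset.mem_range.1 hi)).le
    have := lt_of_le_of_ne hrs' (inv_ne_zero hrs).symm
    positivity
  · have : ‖g x‖ ≤ (1 + ∑ i ∈ Finset.range s, ‖f (u i)‖ * C i) * r x := by
      simp only [g, LinearMap.sub_apply, LinearMap.sum_apply, LinearMap.smul_apply, smul_eq_mul]
      refine (norm_sub_le _ _).trans ?_
      rw [add_mul, one_mul, Finset.sum_mul]
      refine add_le_add (hf x) ((norm_sum_le _ _).trans (Finset.sum_le_sum fun i hi => ?_))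
      rw [norm_mul, mul_assoc]
      gcongr
      exact hφC i (Finset.mem_range.1 hi) x
    simp only [LinearMap.smul_apply, norm_smul, norm_inv, RCLike.norm_ofReal,
      abs_of_nonneg (apply_nonneg r (u s))]
    rw [mul_assoc]
    gcongr
  · have hsum : ∑ i ∈ Finset.range s, f (u i) * φ i (u j) = if j < s then f (u j) else 0 := by
      rw [Finset.sum_congr rfl fun i hi => by rw [hφu i (Finset.mem_range.1 hi) j]]
      simp
    simp only [g, LinearMap.smul_apply, LinearMap.sub_apply, LinearMap.sum_apply, smul_eq_mul,
      hsum]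
    rcases lt_trichotomy j s with h | rfl | h
    · simp [h, h.ne']
    · simp [hfs, hrs]
    · simp [hfj j h, h.ne, h.not_gt]

theorem exists_normalized_basic_sequence [TopologicalSpace E] [IsTopologicalAddGroup E]
    [ContinuousSMul 𝕜 E] {P : ℕ → Seminorm 𝕜 E} (hPc : ∀ n, Continuous (P n))
    (hP0 : ∀ n x, P n x = 0 → x = 0) {M : ℕ → Submodule 𝕜 E}
    (hM : ∀ j, ¬ FiniteDimensional 𝕜 (M j)) :
    ∃ (u : ℕ → E) (φ : ℕ → Module.Dual 𝕜 E), (∀ j, u j ∈ M j) ∧ (∀ j x, ‖φ j x‖ ≤ P 0 x) ∧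
      (∀ i j, φ i (u j) = if i = j then 1 else 0) ∧
      ∀ n t, n ≤ t → ∀ x ∈ Submodule.span 𝕜 (u '' Set.Iio t),
        ∀ y ∈ Submodule.span 𝕜 (u '' Set.Ici t), P n x ≤ 2 * P n (x + y) := by
  obtain ⟨u, huM, hu0, huf, hu⟩ := exists_basic_sequence hPc hP0 hM
  choose φ hC hφ using exists_biorthogonal (hP0 0) hu0 huf
  choose C hC hφC using hC
  have hC0 : ∀ i, (C i : 𝕜) ≠ 0 := fun i => by exact_mod_cast (hC i).ne'
  have hspan : ∀ A : Set ℕ, Submodule.span 𝕜 ((fun j => (C j : 𝕜) • u j) '' A) ≤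
      Submodule.span 𝕜 (u '' A) := fun A => by
    rw [Submodule.span_le]
    rintro _ ⟨j, hj, rfl⟩
    exact Submodule.smul_mem _ _ (Submodule.subset_span ⟨j, hj, rfl⟩)
  -- Rescaling moves the constant `C j` from the functional to the vector and leaves all spans
  -- unchanged.
  refine ⟨fun j => (C j : 𝕜) • u j, fun j => (C j : 𝕜)⁻¹ • φ j,
    fun j => Submodule.smul_mem _ _ (huM j), fun j x => ?_, fun i j => ?_,
    fun n t hnt x hx y hy => hu n t hnt x (hspan _ hx) y (hspan _ hy)⟩
  · simp only [LinearMap.smul_apply, norm_smul, norm_inv, RCLike.norm_ofReal, abs_of_pos (hC j)]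
    rw [inv_mul_le_iff₀ (hC j)]
    exact hφC j x
  · by_cases h : i = j
    · subst h; simp [hφ, hC0]
    · simp [hφ, h]

/-- Partial sums with respect to a biorthogonal system. -/
noncomputable def partialSum (u : ℕ → E) (φ : ℕ → Module.Dual 𝕜 E) (s : ℕ) : E →ₗ[𝕜] E :=
  ∑ k ∈ Finset.range s, (φ k).smulRight (u k)

theorem partialSum_apply (u : ℕ → E) (φ : ℕ → Module.Dual 𝕜 E) (s : ℕ) (x : E) :
    partialSum u φ s x = ∑ k ∈ Finset.range s, φ k x • u k := by
  simp [partialSum]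

section PartialSum

variable {u : ℕ → E} {φ : ℕ → Module.Dual 𝕜 E}

theorem partialSum_apply_self (hφ : ∀ i j, φ i (u j) = if i = j then 1 else 0)
    (s j : ℕ) :
    partialSum u φ s (u j) = if j < s then u j else 0 := by
  simp [partialSum_apply, hφ]

theorem partialSum_mem_span (s : ℕ) (x : E) :
    partialSum u φ s x ∈ Submodule.span 𝕜 (u '' Set.Iio s) := by
  rw [partialSum_apply]
  exact Submodule.sum_mem _ fun k hk => Submodule.smul_mem _ _
    (Submodule.subset_span ⟨k, Finset.mem_range.1 hk, rfl⟩)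

theorem sub_partialSum_mem_span (hφ : ∀ i j, φ i (u j) = if i = j then 1 else 0)
    (s : ℕ) {x : E} (hx : x ∈ Submodule.span 𝕜 (Set.range u)) :
    x - partialSum u φ s x ∈ Submodule.span 𝕜 (u '' Set.Ici s) := by
  have : Submodule.span 𝕜 (Set.range u) ≤
      (Submodule.span 𝕜 (u '' Set.Ici s)).comap (LinearMap.id - partialSum u φ s) := by
    rw [Submodule.span_le]
    rintro _ ⟨j, rfl⟩
    simp only [SetLike.mem_coe, Submodule.mem_comap, LinearMap.sub_apply, LinearMap.id_apply,
      partialSum_apply_self hφ]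
    split_ifs with h
    · simp
    · rw [sub_zero]
      exact Submodule.subset_span ⟨j, not_lt.1 h, rfl⟩
  exact this hx

theorem exists_partialSum_eq (hφ : ∀ i j, φ i (u j) = if i = j then 1 else 0)
    {x : E} (hx : x ∈ Submodule.span 𝕜 (Set.range u)) :
    ∃ s₀, ∀ s ≥ s₀, partialSum u φ s x = x := by
  induction hx using Submodule.span_induction with
  | mem x hx =>
    obtain ⟨j, rfl⟩ := hx
    exact ⟨j + 1, fun s hs => by rw [partialSum_apply_self hφ, if_pos (by omega)]⟩
  | zero => exact ⟨0, by simp⟩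
  | add x y _ _ hx hy =>
    obtain ⟨a, ha⟩ := hx
    obtain ⟨b, hb⟩ := hy
    exact ⟨max a b, fun s hs => by
      rw [map_add, ha s (le_of_max_le_left hs), hb s (le_of_max_le_right hs)]⟩
  | smul c x _ hx =>
    obtain ⟨a, ha⟩ := hx
    exact ⟨a, fun s hs => by rw [map_smul, ha s hs]⟩

theorem linearIndependent_of_biorthogonal
    (hφ : ∀ i j, φ i (u j) = if i = j then 1 else 0) : LinearIndependent 𝕜 u := by
  rw [linearIndependent_iff']
  intro s g hg i hi
  have := congrArg (φ i) hg
  simpa [map_sum, hφ, hi] using this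

end PartialSum

/-- In the closed span of a basic sequence the partial sums converge. -/
theorem partialSum_properties [TopologicalSpace E] [IsTopologicalAddGroup E]
    [ContinuousSMul 𝕜 E] {P : ℕ → Seminorm 𝕜 E} (hPc : ∀ n, Continuous (P n))
    {u : ℕ → E} {φ : ℕ → Module.Dual 𝕜 E} (hφc : ∀ i, Continuous (φ i))
    (hφ : ∀ i j, φ i (u j) = if i = j then 1 else 0)
    (hu : ∀ n t, n ≤ t → ∀ x ∈ Submodule.span 𝕜 (u '' Set.Iio t),
        ∀ y ∈ Submodule.span 𝕜 (u '' Set.Ici t), P n x ≤ 2 * P n (x + y))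
    {x : E} (hx : x ∈ (Submodule.span 𝕜 (Set.range u)).topologicalClosure) :
    (∀ s, x - partialSum u φ s x ∈ (Submodule.span 𝕜 (u '' Set.Ici s)).topologicalClosure) ∧
      ∀ n, Tendsto (fun s => P n (x - partialSum u φ s x)) atTop (𝓝 0) := by
  have hSc : ∀ s, Continuous (partialSum u φ s) := fun s => by
    have : (partialSum u φ s : E → E) = fun x => ∑ k ∈ Finset.range s, φ k x • u k :=
      funext fun x => partialSum_apply u φ s x
    rw [this]
    exact continuous_finsetSum _ fun k _ => (hφc k).smul continuous_const
  have hcl : x ∈ closure (Submodule.span 𝕜 (Set.range u) : Set E) := hx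
  refine ⟨fun s => ?_, fun n => ?_⟩
  · exact map_mem_closure (f := fun x => x - partialSum u φ s x)
      (continuous_id.sub (hSc s)) hcl fun y hy => sub_partialSum_mem_span hφ s hy
  -- For `s ≥ n` the partial sums are bounded by 2 for `P n`, first on the span and then on its
  -- closure. Convergence on the span, where they are eventually the identity, therefore extends to
  -- the closure.
  · have hbound : ∀ s ≥ n, ∀ z ∈ closure (Submodule.span 𝕜 (Set.range u) : Set E),
        P n (partialSum u φ s z) ≤ 2 * P n z := fun s hs z hz => by
      have hclosed : IsClosed {z | P n (partialSum u φ s z) ≤ 2 * P n z} :=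
        isClosed_le ((hPc n).comp (hSc s)) (continuous_const.mul (hPc n))
      refine closure_minimal (fun y hy => ?_) hclosed hz
      have := hu n s hs _ (partialSum_mem_span (φ := φ) s y) _ (sub_partialSum_mem_span hφ s hy)
      simpa using this
    rw [Metric.tendsto_atTop]
    intro ε hε
    have hopen : {w | P n (x - w) < ε / 3} ∈ 𝓝 x := by
      refine (isOpen_lt ((hPc n).comp (continuous_const.sub continuous_id))
        continuous_const).mem_nhds ?_
      simp; linarith
    obtain ⟨w, hw, hws⟩ := mem_closure_iff_nhds.1 hcl _ hopen
    obtain ⟨s₀, hs₀⟩ := exists_partialSum_eq hφ hws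
    refine ⟨max s₀ n, fun s hs => ?_⟩
    have hxw : x - w ∈ closure (Submodule.span 𝕜 (Set.range u) : Set E) :=
      Submodule.sub_mem (Submodule.span 𝕜 (Set.range u)).topologicalClosure hx
        (subset_closure hws)
    have h1 := hbound s (le_of_max_le_right hs) _ hxw
    have h2 : x - partialSum u φ s x = (x - w) - partialSum u φ s (x - w) := by
      rw [map_sub, hs₀ s (le_of_max_le_left hs)]; abel
    have hw' : P n (x - w) < ε / 3 := hw
    rw [Real.dist_eq, sub_zero, abs_of_nonneg (apply_nonneg _ _), h2]
    calc P n ((x - w) - partialSum u φ s (x - w))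
        ≤ P n (x - w) + P n (partialSum u φ s (x - w)) := map_sub_le_add _ _ _
      _ < ε := by linarith

end

/-! ### Seminorm families and small perturbations of the identity -/

section

variable {𝕜 : Type*} [RCLike 𝕜] {X : Type*} [AddCommGroup X] [Module 𝕜 X]

theorem seminorm_sum_le {ι : Type*} (q : Seminorm 𝕜 X) (t : Finset ι) (f : ι → X) :
    q (∑ i ∈ t, f i) ≤ ∑ i ∈ t, q (f i) :=
  Finset.le_sum_of_subadditive q (map_zero q).le (map_add_le_add q) t f

theorem seminorm_sum_apply {ι : Type*} (t : Finset ι) (q : ι → Seminorm 𝕜 X) (x : X) :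
    (∑ i ∈ t, q i) x = ∑ i ∈ t, q i x := by
  classical
  induction t using Finset.induction_on with
  | empty => simp
  | insert i t hi ih => simp [Finset.sum_insert hi, ih]

/-- Joining the continuous norm `r` to each partial supremum turns the family into an increasing
family of norms. -/
theorem withSeminorms_sup_partialSups [TopologicalSpace X] {p : SeminormFamily 𝕜 X ℕ}
    (hp : WithSeminorms p) {r : Seminorm 𝕜 X} (hr : Continuous r) :
    WithSeminorms (fun i => (Finset.Iic i).sup p ⊔ r : SeminormFamily 𝕜 X ℕ) := by
  have hps := hp.partial_sups
  refine hps.congr (fun i => ?_) (fun i => ⟨{i}, 1, ?_⟩)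
  · obtain ⟨s, C, -, hC⟩ := Seminorm.bound_of_continuous hps r hr
    refine ⟨insert i s, 1 + C, ?_⟩
    intro x
    have h1 : (Finset.Iic i).sup p x ≤
        ((insert i s).sup fun i => (Finset.Iic i).sup p) x :=
      Seminorm.le_def.1 (Finset.le_sup (f := fun i => (Finset.Iic i).sup p)
        (Finset.mem_insert_self i s)) x
    have h2 : (s.sup fun i => (Finset.Iic i).sup p) x ≤
        ((insert i s).sup fun i => (Finset.Iic i).sup p) x :=
      Seminorm.le_def.1 (Finset.sup_mono (Finset.subset_insert i s)) x
    have h3 : r x ≤ C * (s.sup fun i => (Finset.Iic i).sup p) x := hC x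
    have h4 : (C : ℝ) * (s.sup fun i => (Finset.Iic i).sup p) x ≤
      C * ((insert i s).sup fun i => (Finset.Iic i).sup p) x := by gcongr
    have h0 : 0 ≤ (C : ℝ) * ((insert i s).sup fun i => (Finset.Iic i).sup p) x := by positivity
    have h0' : 0 ≤ ((insert i s).sup fun i => (Finset.Iic i).sup p) x := apply_nonneg _ _
    change max ((Finset.Iic i).sup p x) (r x) ≤
      ((1 : ℝ) + C) * ((insert i s).sup fun i => (Finset.Iic i).sup p) x
    rw [add_mul, one_mul]
    exact max_le (by linarith) (by linarith)
  · intro x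
    simp

theorem monotone_partialSups_seminorm (p : SeminormFamily 𝕜 X ℕ) (r : Seminorm 𝕜 X) :
    Monotone fun i => (Finset.Iic i).sup p ⊔ r := fun _ _ hij =>
  sup_le_sup_right (Finset.sup_mono (Finset.Iic_subset_Iic.2 hij)) r

variable [UniformSpace X] [IsUniformAddGroup X] {P : SeminormFamily 𝕜 X ℕ}

theorem cauchySeq_of_withSeminorms (hP : WithSeminorms P) {f : ℕ → X}
    (h : ∀ i, ∀ ε > 0, ∃ N, ∀ m ≥ N, P i (f m - f N) < ε) : CauchySeq f := by
  rw [cauchySeq_iff_tendsto, uniformity_eq_comap_nhds_zero, tendsto_comap_iff, hP.tendsto_nhds]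
  intro i ε hε
  obtain ⟨N, hN⟩ := h i (ε / 2) (by positivity)
  filter_upwards [eventually_ge_atTop ((N, N) : ℕ × ℕ)] with m hm
  have h1 := hN m.1 hm.1
  have h2 := hN m.2 hm.2
  have h3 : f m.2 - f m.1 - 0 = (f m.2 - f N) - (f m.1 - f N) := by abel
  simp only [Function.comp_apply, Prod.map]
  rw [h3]
  exact (map_sub_le_add _ _ _).trans_lt (by linarith)

theorem exists_linearMap_sum [T2Space X] [CompleteSpace X] (hP : WithSeminorms P)
    (r : Seminorm 𝕜 X) (A : ℕ → X →ₗ[𝕜] X) (b : ℕ → ℕ → ℝ)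
    (hA : ∀ n s x, P n (A s x) ≤ b n s * r x) (hb : ∀ n, Summable (b n))
    (hb0 : ∀ n s, 0 ≤ b n s) :
    ∃ K : X →ₗ[𝕜] X, (∀ x, Tendsto (fun N => ∑ s ∈ Finset.range N, A s x) atTop (𝓝 (K x))) ∧
      ∀ x (q : Seminorm 𝕜 X), Continuous q → ∀ B : ℝ,
        (∀ N, q (∑ s ∈ Finset.range N, A s x) ≤ B) → q (K x) ≤ B := by
  have := hP.topologicalAddGroup
  have := hP.continuousSMul
  have hlim : ∀ x, ∃ y, Tendsto (fun N => ∑ s ∈ Finset.range N, A s x) atTop (𝓝 y) := by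
    intro x
    refine cauchySeq_tendsto_of_complete (cauchySeq_of_withSeminorms hP fun n ε hε => ?_)
    have hr : 0 < r x + 1 := by have := apply_nonneg r x; linarith
    obtain ⟨N, hN⟩ := Metric.cauchySeq_iff'.1 (hb n).hasSum.tendsto_sum_nat.cauchySeq
      (ε / (r x + 1)) (by positivity)
    refine ⟨N, fun m hm => ?_⟩
    have h1 := hN m hm
    rw [Real.dist_eq, ← Finset.sum_Ico_eq_sub _ hm,
      abs_of_nonneg (Finset.sum_nonneg fun s _ => hb0 n s), lt_div_iff₀ hr] at h1
    rw [← Finset.sum_Ico_eq_sub _ hm]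
    calc P n (∑ s ∈ Finset.Ico N m, A s x) ≤ ∑ s ∈ Finset.Ico N m, P n (A s x) := seminorm_sum_le ..
      _ ≤ ∑ s ∈ Finset.Ico N m, b n s * r x := Finset.sum_le_sum fun s _ => hA n s x
      _ = (∑ s ∈ Finset.Ico N m, b n s) * r x := by rw [Finset.sum_mul]
      _ ≤ (∑ s ∈ Finset.Ico N m, b n s) * (r x + 1) := by
        gcongr
        · exact Finset.sum_nonneg fun s _ => hb0 n s
        · linarith
      _ < ε := h1
  choose k hk using hlim
  refine ⟨linearMapOfTendsto k (l := atTop) (fun N => ∑ s ∈ Finset.range N, A s) ?_, fun x => hk x,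
    fun x q hq B hB => ?_⟩
  · rw [tendsto_pi_nhds]
    intro x
    simpa using hk x
  · exact le_of_tendsto ((hq.tendsto _).comp (hk x)) (Eventually.of_forall hB)

/-- Contraction in the single norm `r` gives `r x ≤ 2 * r (x + K x)`. Since `K` is bounded from `r`
to every `P n`, each `P n x` is then controlled by seminorms of `x + K x`, so a convergent sequence
of images has Cauchy preimages. -/
theorem isClosed_map_id_add [T2Space X] [CompleteSpace X] (hP : WithSeminorms P)
    {r : Seminorm 𝕜 X} (hr : Continuous r) (hr0 : ∀ x, r x = 0 → x = 0) (K : X →ₗ[𝕜] X)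
    (hK : ∀ x, r (K x) ≤ 1 / 2 * r x) (hKP : ∀ n, ∃ D : ℝ, 0 ≤ D ∧ ∀ x, P n (K x) ≤ D * r x)
    {U : Submodule 𝕜 X} (hU : IsClosed (U : Set X)) :
    IsClosed (U.map (LinearMap.id + K) : Set X) ∧
      Function.Injective (LinearMap.id + K : X →ₗ[𝕜] X) := by
  have := hP.topologicalAddGroup
  have := hP.continuousSMul
  have := hP.firstCountableTopology
  have hKc : Continuous K := by
    refine WithSeminorms.continuous_of_isBounded hP hP K ?_
    obtain ⟨s, C, -, hC⟩ := Seminorm.bound_of_continuous hP r hr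
    intro n
    obtain ⟨D, hD0, hD⟩ := hKP n
    refine ⟨s, ⟨D, hD0⟩ * C, fun x => (hD x).trans ?_⟩
    have := hC x
    change D * r x ≤ (D * C) * (s.sup P) x
    rw [mul_assoc]
    exact mul_le_mul_of_nonneg_left this hD0
  have hrle : ∀ x, r x ≤ 2 * r (x + K x) := fun x => by
    have h1 : r x ≤ r (x + K x) + r (K x) := by
      simpa using map_sub_le_add r (x + K x) (K x)
    linarith [hK x]
  have hPle : ∀ n, ∃ D : ℝ, 0 ≤ D ∧ ∀ x, P n x ≤ P n (x + K x) + D * r (x + K x) := fun n => by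
    obtain ⟨D, hD0, hD⟩ := hKP n
    refine ⟨D * 2, by positivity, fun x => ?_⟩
    have h1 : P n x ≤ P n (x + K x) + P n (K x) := by
      simpa using map_sub_le_add (P n) (x + K x) (K x)
    have h2 := mul_le_mul_of_nonneg_left (hrle x) hD0
    linarith [hD x]
  refine ⟨?_, ?_⟩
  · refine isClosed_of_closure_subset fun z hz => ?_
    obtain ⟨w, hw, hwz⟩ := mem_closure_iff_seq_limit.1 hz
    choose u huU hu using hw
    have hcu : CauchySeq u := by
      refine cauchySeq_of_withSeminorms hP fun n ε hε => ?_
      obtain ⟨D, hD0, hD⟩ := hPle n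
      have hc := hwz.cauchySeq
      rw [cauchySeq_iff_tendsto, uniformity_eq_comap_nhds_zero, tendsto_comap_iff] at hc
      have hq : Continuous fun x => P n x + D * r x :=
        (hP.continuous_seminorm n).add (continuous_const.mul hr)
      have ht := (hq.tendsto 0).comp hc
      simp only [map_zero, mul_zero, add_zero] at ht
      obtain ⟨N, hN⟩ := eventually_atTop.1 (ht.eventually (gt_mem_nhds hε))
      refine ⟨max N.1 N.2, fun m hm => ?_⟩
      have h1 := hN (max N.1 N.2, m) ⟨le_max_left _ _, (le_max_right _ _).trans hm⟩
      refine lt_of_le_of_lt (hD _) (lt_of_eq_of_lt ?_ h1)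
      have : u m - u (max N.1 N.2) + K (u m - u (max N.1 N.2)) = w m - w (max N.1 N.2) := by
        rw [← hu m, ← hu (max N.1 N.2)]
        simp only [map_sub, LinearMap.add_apply, LinearMap.id_apply]
        abel
      simp only [Function.comp_apply, Prod.map, this]
    obtain ⟨x, hx⟩ := cauchySeq_tendsto_of_complete hcu
    refine ⟨x, hU.mem_of_tendsto hx (Eventually.of_forall huU), ?_⟩
    have h2 : Tendsto (fun k => u k + K (u k)) atTop (𝓝 (x + K x)) :=
      hx.add ((hKc.tendsto x).comp hx)
    refine tendsto_nhds_unique h2 (hwz.congr fun k => ?_)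
    rw [← hu k]; rfl
  · rw [← LinearMap.ker_eq_bot, LinearMap.ker_eq_bot']
    intro x hx
    refine hr0 x (le_antisymm ?_ (apply_nonneg r x))
    have h1 := hrle x
    have h2 : x + K x = 0 := hx
    rwa [h2, map_zero, mul_zero] at h1

end

/-! ### Estimates and choices based on condition (C) -/

section

variable {𝕜 : Type*} [RCLike 𝕜]
  {X : Type*} [AddCommGroup X] [Module 𝕜 X]
  {Y : Type*} [AddCommGroup Y] [Module 𝕜 Y]

/-- For k < s the terms `a k • e k` are absorbed by `u`, leaving its tail. In `2 * s + 4`, the 2s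
counts the remaining terms with k < s, two per index; 2 comes from k = s, and 2 from the geometric
series over k > s. -/
theorem seminorm_perturbed_sub_le (q : Seminorm 𝕜 Y) (L : X →ₗ[𝕜] Y) {e v x : ℕ → X} {a b : ℕ → 𝕜}
    {R : ℝ} (ha : ∀ k, ‖a k‖ ≤ R) (hb : ∀ k, ‖b k‖ ≤ R) {s : ℕ} {y : Y}
    (hv : ∀ k < s, q (L (v k)) ≤ (1 / 2) ^ s) (hx : ∀ k < s, q (L (x k)) ≤ (1 / 2) ^ s)
    (hy : q (L (x s) - y) ≤ (1 / 2) ^ s)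
    (hd : ∀ k, s ≤ k → q (L (v k - e k)) ≤ (1 / 2) ^ k)
    (hx' : ∀ k, s < k → q (L (x k)) ≤ (1 / 2) ^ k) (u : X) {N : ℕ} (hN : s + 1 ≤ N) :
    q (L (u + ∑ k ∈ Finset.range N, (a k • (v k - e k) + b k • x k)) - b s • y) ≤
      q (L (u - ∑ k ∈ Finset.range s, a k • e k)) + R * (2 * s + 4) * (1 / 2) ^ s := by
  have hR : 0 ≤ R := (norm_nonneg _).trans (ha 0)
  have hmul : ∀ (c : 𝕜) (z : Y) (δ : ℝ), ‖c‖ ≤ R → q z ≤ δ → q (c • z) ≤ R * δ :=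
    fun c z δ hc hz => by
      rw [map_smul_eq_mul]
      exact mul_le_mul hc hz (apply_nonneg _ _) hR
  suffices h : ∀ m : ℕ,
      q (L (u + ∑ k ∈ Finset.range (s + 1 + m), (a k • (v k - e k) + b k • x k)) - b s • y) ≤
      q (L (u - ∑ k ∈ Finset.range s, a k • e k)) + R * (2 * s + 2) * (1 / 2) ^ s +
        2 * R * ((1 / 2) ^ s - (1 / 2) ^ (s + m)) by
    obtain ⟨m, rfl⟩ := Nat.exists_eq_add_of_le hN
    have h0 : 0 ≤ R * (1 / 2) ^ (s + m) := by positivity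
    refine (h m).trans ?_
    linarith
  intro m
  induction m with
  | zero =>
    have heq : L (u + ∑ k ∈ Finset.range (s + 1 + 0), (a k • (v k - e k) + b k • x k)) - b s • y =
        L (u - ∑ k ∈ Finset.range s, a k • e k) +
          (∑ k ∈ Finset.range s, (a k • L (v k) + b k • L (x k)) +
            (a s • L (v s - e s) + b s • (L (x s) - y))) := by
      rw [add_zero, Finset.sum_range_succ]
      simp only [map_add, map_sub, map_sum, map_smul, smul_sub, Finset.sum_add_distrib,
        Finset.sum_sub_distrib]
      abel
    rw [heq]
    have h1 : q (∑ k ∈ Finset.range s, (a k • L (v k) + b k • L (x k))) ≤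
        s * (2 * (R * (1 / 2) ^ s)) := by
      refine (seminorm_sum_le q _ _).trans ?_
      refine (Finset.sum_le_card_nsmul _ _ (2 * (R * (1 / 2) ^ s)) fun k hk => ?_).trans ?_
      · have hk := Finset.mem_range.1 hk
        refine (map_add_le_add q _ _).trans ?_
        linarith [hmul _ _ _ (ha k) (hv k hk), hmul _ _ _ (hb k) (hx k hk)]
      · simp
    have h2 := hmul _ _ _ (ha s) (hd s le_rfl)
    have h3 := hmul _ _ _ (hb s) hy
    refine (map_add_le_add q _ _).trans ?_
    have h4 := map_add_le_add q (∑ k ∈ Finset.range s, (a k • L (v k) + b k • L (x k)))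
      (a s • L (v s - e s) + b s • (L (x s) - y))
    have h5 := map_add_le_add q (a s • L (v s - e s)) (b s • (L (x s) - y))
    simp only [add_zero, sub_self, mul_zero]
    linarith
  | succ m ih =>
    have heq : L (u + ∑ k ∈ Finset.range (s + 1 + (m + 1)),
        (a k • (v k - e k) + b k • x k)) - b s • y =
        (L (u + ∑ k ∈ Finset.range (s + 1 + m), (a k • (v k - e k) + b k • x k)) - b s • y) +
        (a (s + 1 + m) • L (v (s + 1 + m) - e (s + 1 + m)) +
          b (s + 1 + m) • L (x (s + 1 + m))) := by
      rw [← add_assoc (s + 1) m 1, Finset.sum_range_succ, ← add_assoc u, map_add L (_ + _),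
        map_add L (_ • _), map_smul, map_smul]
      abel
    rw [heq]
    refine (map_add_le_add q _ _).trans ?_
    have h1 := hmul _ _ _ (ha (s + 1 + m)) (hd (s + 1 + m) (by omega))
    have h2 := hmul _ _ _ (hb (s + 1 + m)) (hx' (s + 1 + m) (by omega))
    have h3 := map_add_le_add q (a (s + 1 + m) • L (v (s + 1 + m) - e (s + 1 + m)))
      (b (s + 1 + m) • L (x (s + 1 + m)))
    have h4 : ((1 : ℝ) / 2) ^ (s + 1 + m) = 1 / 2 * (1 / 2) ^ (s + m) := by
      rw [show s + 1 + m = s + m + 1 by omega, pow_succ]; ring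
    have h5 : ((1 : ℝ) / 2) ^ (s + (m + 1)) = 1 / 2 * (1 / 2) ^ (s + m) := by
      rw [← add_assoc, pow_succ]; ring
    rw [h4] at h1 h2
    rw [h5]
    linarith

variable [TopologicalSpace X] [TopologicalSpace Y]

/-- Condition (C) gives no control on the index. Adding large multiples of `Q i ∘ S k`, k < K, to
`r` keeps the images under those `S k` away from a neighbourhood of y ≠ 0, which forces the index to
be at least K. -/
theorem exists_index_ge_mem_dense [T1Space Y] {Q : SeminormFamily 𝕜 Y ℕ} (hQ : WithSeminorms Q)
    {S : ℕ → X →L[𝕜] Y} {X₀ : Set X} (hX₀ : Dense X₀)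
    (hS : ∀ r : Seminorm 𝕜 X, Continuous r → Dense (⋃ k, (fun x => S k x) '' {x : X | r x < 1}))
    (K : ℕ) {r : Seminorm 𝕜 X} (hr : Continuous r) {V : Set Y} (hV : IsOpen V) {y : Y}
    (hy : y ∈ V) : ∃ j ≥ K, ∃ x ∈ X₀, r x < 1 ∧ S j x ∈ V := by
  suffices h : ∃ j ≥ K, ∃ x, r x < 1 ∧ S j x ∈ V by
    obtain ⟨j, hj, x, hx⟩ := h
    have hopen : IsOpen {x | r x < 1 ∧ S j x ∈ V} :=
      (isOpen_lt hr continuous_const).inter (hV.preimage (S j).continuous)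
    obtain ⟨x', hx', hx₀⟩ := hX₀.inter_open_nonempty _ hopen ⟨x, hx⟩
    exact ⟨j, hj, x', hx₀, hx'⟩
  by_cases hy0 : y = 0
  · exact ⟨K, le_rfl, 0, by simp, by simpa [hy0] using hy⟩
  obtain ⟨i, hi⟩ := hQ.separating_of_T1 y hy0
  have hc : 0 < Q i y := lt_of_le_of_ne (apply_nonneg _ _) hi.symm
  let c : NNReal := ⟨2 / Q i y, by positivity⟩
  have hQi : Continuous (Q i) := hQ.continuous_seminorm i
  let r' : Seminorm 𝕜 X := r + ∑ k ∈ Finset.range K, c • (Q i).comp (S k).toLinearMap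
  have hr'_apply : ∀ x, r' x = r x + ∑ k ∈ Finset.range K, 2 / Q i y * Q i (S k x) := fun x => by
    simp only [r', add_apply, seminorm_sum_apply, smul_apply, NNReal.smul_def]
    rfl
  have hr' : Continuous r' := by
    have : (r' : X → ℝ) = fun x => r x + ∑ k ∈ Finset.range K, 2 / Q i y * Q i (S k x) :=
      funext hr'_apply
    rw [this]
    exact hr.add (continuous_finsetSum _ fun k _ =>
      continuous_const.mul (hQi.comp (S k).continuous))
  have hV' : IsOpen (V ∩ {z | Q i y / 2 < Q i z}) := hV.inter (isOpen_lt continuous_const hQi)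
  obtain ⟨z, ⟨hzV, hz⟩, hz'⟩ := (hS r' hr').inter_open_nonempty _ hV'
    ⟨y, hy, by simp only [Set.mem_ofPred_eq]; linarith⟩
  obtain ⟨k, x, hx, rfl⟩ := Set.mem_iUnion.1 hz'
  have hx' : r x + ∑ k ∈ Finset.range K, 2 / Q i y * Q i (S k x) < 1 := hr'_apply x ▸ hx
  have hnn : ∀ k ∈ Finset.range K, 0 ≤ 2 / Q i y * Q i (S k x) := fun k _ => by positivity
  refine ⟨k, ?_, x, ?_, hzV⟩
  · by_contra! hk
    have h1 := Finset.single_le_sum hnn (Finset.mem_range.2 hk)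
    have h2 : 2 / Q i y * (Q i y / 2) = 1 := by field_simp
    have h3 : 2 / Q i y * (Q i y / 2) < 2 / Q i y * Q i (S k x) := by
      have h4 : Q i y / 2 < Q i (S k x) := hz
      gcongr
    linarith [apply_nonneg r x]
  · linarith [Finset.sum_nonneg hnn]

theorem exists_dense_approx [IsTopologicalAddGroup X] {P : ℕ → Seminorm 𝕜 X}
    (hP : ∀ n, Continuous (P n)) {Q : ℕ → Seminorm 𝕜 Y} (hQ : ∀ n, Continuous (Q n))
    {S : ℕ → X →L[𝕜] Y} {X₀ : Set X} (hX₀ : Dense X₀) (u : ℕ → X) {ε : ℕ → ℝ}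
    (hε : ∀ j, 0 < ε j) :
    ∃ v : ℕ → X, (∀ j, v j ∈ X₀) ∧ ∀ j, P j (v j - u j) ≤ ε j / 8 ∧
      ∀ i ≤ j, Q j (S i (v j - u j)) ≤ ε j := by
  have h : ∀ j, ∃ v ∈ X₀, P j (v - u j) ≤ ε j / 8 ∧ ∀ i ≤ j, Q j (S i (v - u j)) ≤ ε j := by
    intro j
    have h1 : ∀ᶠ v in 𝓝 (u j), P j (v - u j) < ε j / 8 := by
      have : Continuous fun v => P j (v - u j) := (hP j).comp (continuous_id.sub continuous_const)
      refine this.continuousAt.eventually_lt continuousAt_const ?_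
      have := hε j
      simp [this]
    have h2 : ∀ᶠ v in 𝓝 (u j), ∀ i ∈ Set.Iic j, Q j (S i (v - u j)) < ε j := by
      refine (Set.finite_Iic j).eventually_all.2 fun i _ => ?_
      have : Continuous fun v => Q j (S i (v - u j)) :=
        (hQ j).comp ((S i).continuous.comp (continuous_id.sub continuous_const))
      refine this.continuousAt.eventually_lt continuousAt_const ?_
      simp [hε j]
    obtain ⟨v, ⟨hv1, hv2⟩, hv⟩ := mem_closure_iff_nhds.1 (hX₀ (u j)) _ (h1.and h2)
    exact ⟨v, hv, hv1.le, fun i hi => (hv2 i hi).le⟩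
  choose v hv hv' using h
  exact ⟨v, hv, hv'⟩

theorem exists_perturbation_sequence [T1Space Y] {P : ℕ → Seminorm 𝕜 X}
    (hP : ∀ n, Continuous (P n)) {Q : SeminormFamily 𝕜 Y ℕ} (hQ : WithSeminorms Q)
    {S : ℕ → X →L[𝕜] Y} {X₀ : Set X} (hX₀ : Dense X₀)
    (hS₀ : ∀ x ∈ X₀, Tendsto (fun k => S k x) atTop (𝓝 0))
    (hS : ∀ r : Seminorm 𝕜 X, Continuous r → Dense (⋃ k, (fun x => S k x) '' {x : X | r x < 1}))
    {v : ℕ → X} (hv : ∀ j, v j ∈ X₀) (y : ℕ → Y) {ε : ℕ → ℝ} (hε : ∀ j, 0 < ε j) :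
    ∃ (J : ℕ → ℕ) (x : ℕ → X), StrictMono J ∧ ∀ s, P s (x s) ≤ ε s / 8 ∧
      Q s (S (J s) (x s) - y s) ≤ ε s ∧ ∀ i < s, Q s (S (J s) (v (J i))) ≤ ε s ∧
        Q s (S (J s) (x i)) ≤ ε s ∧ Q s (S (J i) (x s)) ≤ ε s := by
  have := hQ.topologicalAddGroup
  have hQc := hQ.continuous_seminorm
  obtain ⟨f, hf⟩ := exists_seq_of_forall_history
    -- Keeping each x_i in X₀ makes `S j (x i)` tend to 0, so later indices can make these cross
    -- terms small.
    (fun s (g : Fin s → ℕ × X₀) (a : ℕ × X₀) => (∀ i, (g i).1 < a.1) ∧ P s a.2 ≤ ε s / 8 ∧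
      Q s (S a.1 a.2 - y s) ≤ ε s ∧ ∀ i, Q s (S a.1 (v (g i).1)) ≤ ε s ∧
        Q s (S a.1 (g i).2) ≤ ε s ∧ Q s (S (g i).1 a.2) ≤ ε s) (fun s g => by
      have hsmall : ∀ x ∈ X₀, ∀ᶠ j in atTop, Q s (S j x) < ε s := fun x hx => by
        have := ((hQc s).tendsto 0).comp (hS₀ x hx)
        rw [map_zero] at this
        exact this.eventually (gt_mem_nhds (hε s))
      have hev : ∀ᶠ j in atTop, ∀ i, (g i).1 < j ∧ Q s (S j (v (g i).1)) < ε s ∧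
          Q s (S j (g i).2) < ε s := eventually_all.2 fun i =>
        (eventually_gt_atTop _).and ((hsmall _ (hv _)).and (hsmall _ (g i).2.2))
      obtain ⟨K, hK⟩ := eventually_atTop.1 hev
      let c : NNReal := ⟨8 / ε s, by have := hε s; positivity⟩
      -- `r x < 1` bounds `P s x` and all images under the earlier operators by `ε s / 8` at once.
      let r : Seminorm 𝕜 X := c • (P s + ∑ i, (Q s).comp (S (g i).1).toLinearMap)
      have hr_apply : ∀ x, r x = 8 / ε s * (P s x + ∑ i, Q s (S (g i).1 x)) := fun x => by
        simp only [r, add_apply, seminorm_sum_apply, smul_apply, NNReal.smul_def]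
        rfl
      have hr : Continuous r := by
        have : (r : X → ℝ) = fun x => 8 / ε s * (P s x + ∑ i, Q s (S (g i).1 x)) :=
          funext hr_apply
        rw [this]
        exact continuous_const.mul ((hP s).add (continuous_finsetSum _ fun i _ =>
          (hQc s).comp (S (g i).1).continuous))
      have hV : IsOpen {z | Q s (z - y s) < ε s} :=
        isOpen_lt ((hQc s).comp (continuous_id.sub continuous_const)) continuous_const
      obtain ⟨j, hj, x, hx₀, hrx, hxV⟩ := exists_index_ge_mem_dense hQ hX₀ hS K hr hV
        (y := y s) (by simp [hε s])
      rw [hr_apply, div_mul_eq_mul_div, div_lt_one (hε s)] at hrx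
      have hnn : ∀ i ∈ Finset.univ, 0 ≤ Q s (S (g i).1 x) := fun i _ => apply_nonneg _ _
      have hsum := Finset.sum_nonneg hnn
      have hPx := apply_nonneg (P s) x
      refine ⟨(j, ⟨x, hx₀⟩), fun i => (hK j hj i).1, ?_, le_of_lt hxV, fun i =>
        ⟨(hK j hj i).2.1.le, (hK j hj i).2.2.le, ?_⟩⟩
      · simp only; linarith
      · have := Finset.single_le_sum hnn (Finset.mem_univ i)
        simp only; linarith)
  refine ⟨fun s => (f s).1, fun s => (f s).2, strictMono_nat_of_lt_succ fun s =>
    (hf (s + 1)).1 ⟨s, by omega⟩, fun s => ⟨(hf s).2.1, (hf s).2.2.1, fun i hi =>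
    (hf s).2.2.2 ⟨i, hi⟩⟩⟩

end

/-! ### The perturbation operator and the hypercyclic subspace -/

section

variable {𝕜 : Type*} [RCLike 𝕜]

theorem not_finiteDimensional_of_linearIndependent {E : Type*} [AddCommGroup E] [Module 𝕜 E]
    {e : ℕ → E} (he : LinearIndependent 𝕜 e) {U : Submodule 𝕜 E} (heU : ∀ k, e k ∈ U) :
    ¬ FiniteDimensional 𝕜 U := fun _ => by
  have h : LinearIndependent 𝕜 fun k => (⟨e k, heU k⟩ : U) :=
    LinearIndependent.of_comp U.subtype he
  have := h.finite
  exact not_finite ℕ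

theorem tendsto_natPair_and_unpair (κ l : ℕ) :
    Tendsto (fun t => Nat.pair (Nat.pair κ l) t) atTop atTop ∧
      ∀ t, (Nat.unpair (Nat.unpair (Nat.pair (Nat.pair κ l) t)).1) = (κ, l) :=
  ⟨tendsto_atTop_mono (fun t => Nat.right_le_pair _ t) tendsto_id, fun t => by simp⟩

theorem continuous_dual_of_le {E : Type*} [AddCommGroup E] [Module 𝕜 E] [TopologicalSpace E]
    [IsTopologicalAddGroup E] {r : Seminorm 𝕜 E} (hr : Continuous r) {f : Module.Dual 𝕜 E}
    (hf : ∀ x, ‖f x‖ ≤ r x) : Continuous f := by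
  refine continuous_of_continuousAt_zero f ?_
  have h := hr.tendsto 0
  rw [map_zero] at h
  rw [ContinuousAt, map_zero]
  exact squeeze_zero_norm hf h

variable {Y : Type*} [AddCommGroup Y] [Module 𝕜 Y] [TopologicalSpace Y]
    [TopologicalSpace.SeparableSpace Y]

/-- Along the indices coding the pair (k₀, l), `z` converges to a times the l-th point of a dense
sequence; since a ≠ 0, these limits are dense. -/
theorem dense_of_approx {Q : SeminormFamily 𝕜 Y ℕ} (hQ : WithSeminorms Q) {a : 𝕜}
    (ha : a ≠ 0) {D : Set Y} {z : ℕ → Y} (hz : ∀ s, z s ∈ D) {k₀ : ℕ}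
    (hmain : ∀ i, ∃ G : ℕ → ℝ, Tendsto G atTop (𝓝 0) ∧ ∀ᶠ s in atTop,
      (Nat.unpair (Nat.unpair s).1).1 = k₀ → Q i (z s - a •
        TopologicalSpace.denseSeq Y (Nat.unpair (Nat.unpair s).1).2) ≤ G s) : Dense D := by
  have := hQ.continuousSMul
  rw [dense_iff_inter_open]
  rintro W hW ⟨y₀, hy₀⟩
  obtain ⟨_, hl, ⟨l, rfl⟩⟩ := (TopologicalSpace.denseRange_denseSeq Y).inter_open_nonempty
    ((fun z => a • z) ⁻¹' W) (hW.preimage (continuous_const_smul _))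
    ⟨(a)⁻¹ • y₀, by simpa [smul_smul, ha] using hy₀⟩
  obtain ⟨hσ, hσ'⟩ := tendsto_natPair_and_unpair k₀ l
  have hconv : Tendsto (fun t => z (Nat.pair (Nat.pair k₀ l) t)) atTop (𝓝 (a • TopologicalSpace.denseSeq Y l)) := by
    rw [hQ.tendsto_nhds]
    intro i ε hε
    obtain ⟨G, hG, hGle⟩ := hmain i
    filter_upwards [hσ.eventually hGle, (hG.comp hσ).eventually (gt_mem_nhds hε)] with t h1 h2
    have h3 := h1 (by rw [hσ'])
    simp only [hσ'] at h3
    exact h3.trans_lt h2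
  obtain ⟨t, ht⟩ := (hconv.eventually (hW.mem_nhds hl)).exists
  exact ⟨_, ht, hz _⟩

variable {X : Type*} [AddCommGroup X] [Module 𝕜 X] [UniformSpace X] [IsUniformAddGroup X]
    [T2Space X] [CompleteSpace X]

/-- The two factors 1/8 add up to 1/4, and the sum 2 of the geometric series turns this into the
contraction constant 1/2. -/
theorem exists_perturbation_operator {P : SeminormFamily 𝕜 X ℕ} (hP : WithSeminorms P)
    (hPmono : Monotone P) {f g : ℕ → Module.Dual 𝕜 X} (hf : ∀ s z, ‖f s z‖ ≤ P 0 z)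
    (hg : ∀ s z, ‖g s z‖ ≤ P 0 z) {d x : ℕ → X} (hd : ∀ s, P s (d s) ≤ (1 / 2) ^ s / 8)
    (hx : ∀ s, P s (x s) ≤ (1 / 2) ^ s / 8) :
    ∃ K : X →ₗ[𝕜] X,
      (∀ z, Tendsto (fun N => ∑ s ∈ Finset.range N, (f s z • d s + g s z • x s)) atTop
        (𝓝 (K z))) ∧
      (∀ z, P 0 (K z) ≤ 1 / 2 * P 0 z) ∧
      ∀ n, ∃ D : ℝ, 0 ≤ D ∧ ∀ z, P n (K z) ≤ D * P 0 z := by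
  have hPc := hP.continuous_seminorm
  let A : ℕ → X →ₗ[𝕜] X := fun s =>
    (f s).smulRight (d s) + (g s).smulRight (x s)
  have hA_apply : ∀ s z, A s z = f s z • d s + g s z • x s := fun s z => rfl
  let b : ℕ → ℕ → ℝ := fun n s => P n (d s) + P n (x s)
  have hb0 : ∀ n s, 0 ≤ b n s := fun n s => add_nonneg (apply_nonneg _ _) (apply_nonneg _ _)
  have hb_le : ∀ n s, n ≤ s → b n s ≤ (1 / 2) ^ s / 4 := fun n s hns => by
    have h1 := (hPmono hns (d s)).trans (hd s)
    have h2 := (hPmono hns (x s)).trans (hx s)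
    simp only [b]
    linarith
  have hb : ∀ n, Summable (b n) := fun n => by
    refine Summable.of_norm_bounded_eventually_nat
      ((summable_geometric_two).div_const 4) ?_
    filter_upwards [eventually_ge_atTop n] with s hs
    rw [Real.norm_of_nonneg (hb0 n s)]
    exact hb_le n s hs
  have hA : ∀ n s z, P n (A s z) ≤ b n s * P 0 z := fun n s z => by
    rw [hA_apply]
    refine (map_add_le_add _ _ _).trans ?_
    rw [map_smul_eq_mul, map_smul_eq_mul, add_mul, mul_comm, mul_comm ‖g s z‖]
    gcongr
    · exact hf _ _
    · exact hg _ _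
  obtain ⟨K, hKlim, hKle⟩ := exists_linearMap_sum hP (P 0) A b hA hb hb0
  have hAsum : ∀ n N z, P n (∑ s ∈ Finset.range N, A s z) ≤
      (∑ s ∈ Finset.range N, b n s) * P 0 z := fun n N z => by
    rw [Finset.sum_mul]
    exact (seminorm_sum_le _ _ _).trans (Finset.sum_le_sum fun s _ => hA n s z)
  refine ⟨K, hKlim, fun z => ?_, fun n => ?_⟩
  · refine hKle z _ (hPc 0) _ fun N => (hAsum 0 N z).trans ?_
    gcongr
    calc ∑ s ∈ Finset.range N, b 0 s ≤ ∑ s ∈ Finset.range N, (1 / 2 : ℝ) ^ s / 4 :=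
          Finset.sum_le_sum fun s _ => hb_le 0 s (Nat.zero_le s)
      _ = (∑ s ∈ Finset.range N, (1 / 2 : ℝ) ^ s) / 4 := by rw [Finset.sum_div]
      _ ≤ 1 / 2 := by linarith [sum_geometric_two_le N]
  · exact ⟨∑' s, b n s, tsum_nonneg (hb0 n), fun z => hKle z _ (hPc n) _ fun N =>
      (hAsum n N z).trans (by gcongr; exact (hb n).sum_le_tsum _ fun s _ => hb0 n s)⟩

theorem exists_hypercyclic_subspace_of_monotone {P : SeminormFamily 𝕜 X ℕ} (hP : WithSeminorms P)
    (hPmono : Monotone P) (hP0 : ∀ x, P 0 x = 0 → x = 0)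
    [T1Space Y] {Q : SeminormFamily 𝕜 Y ℕ} (hQ : WithSeminorms Q) (hQmono : Monotone Q)
    {S : ℕ → X →L[𝕜] Y} {X₀ : Set X} (hX₀ : Dense X₀)
    (hS₀ : ∀ x ∈ X₀, Tendsto (fun k => S k x) atTop (𝓝 0))
    (hS : ∀ r : Seminorm 𝕜 X, Continuous r → Dense (⋃ k, (fun x => S k x) '' {x : X | r x < 1}))
    {M : ℕ → Submodule 𝕜 X} (hManti : Antitone M) (hMclosed : ∀ j, IsClosed (M j : Set X))
    (hMdim : ∀ j, ¬ FiniteDimensional 𝕜 (M j))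
    (hM : ∀ i, ∃ (C : ℝ) (m k : ℕ), 0 ≤ C ∧ ∀ j, k ≤ j → ∀ x ∈ M j, Q i (S j x) ≤ C * P m x) :
    ∃ U : Submodule 𝕜 X, IsClosed (U : Set X) ∧ ¬ FiniteDimensional 𝕜 U ∧
      ∀ x ∈ U, x ≠ 0 → Dense (Set.range fun k => S k x) := by
  have := hP.topologicalAddGroup
  have := hP.continuousSMul
  have := hQ.topologicalAddGroup
  have := hQ.continuousSMul
  have hPc := hP.continuous_seminorm
  have hQc := hQ.continuous_seminorm
  have hP0' : ∀ n x, P n x = 0 → x = 0 := fun n x hx => hP0 x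
    (le_antisymm ((hPmono (Nat.zero_le n) x).trans hx.le) (apply_nonneg _ _))
  obtain ⟨u, φ, huM, hφP, hφu, hu⟩ := exists_normalized_basic_sequence hPc hP0' hMdim
  have hhalf : ∀ j : ℕ, (0 : ℝ) < (1 / 2) ^ j := fun j => by positivity
  have hhalf_anti : ∀ {i j : ℕ}, i ≤ j → ((1 : ℝ) / 2) ^ j ≤ (1 / 2) ^ i := fun h =>
    pow_le_pow_of_le_one (by norm_num) (by norm_num) h
  obtain ⟨v, hv₀, hv⟩ := exists_dense_approx hPc hQc (S := S) hX₀ u hhalf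
  let κ : ℕ → ℕ := fun s => (Nat.unpair (Nat.unpair s).1).1
  let y : ℕ → Y := fun s => TopologicalSpace.denseSeq Y (Nat.unpair (Nat.unpair s).1).2
  obtain ⟨J, x, hJ, hx⟩ := exists_perturbation_sequence hPc hQ hX₀ hS₀ hS hv₀ y hhalf
  have hJle : ∀ s, s ≤ J s := fun s => hJ.le_apply
  let e : ℕ → X := fun k => u (J k)
  let ψ : ℕ → Module.Dual 𝕜 X := fun k => φ (J k)
  have hψe : ∀ i j, ψ i (e j) = if i = j then 1 else 0 := fun i j => by
    simp [ψ, e, hφu, hJ.injective.eq_iff]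
  have hψP : ∀ k x, ‖ψ k x‖ ≤ P 0 x := fun k => hφP (J k)
  have hψc : ∀ k, Continuous (ψ k) := fun k => continuous_dual_of_le (hPc 0) (hψP k)
  have he : ∀ n t, n ≤ t → ∀ x ∈ Submodule.span 𝕜 (e '' Set.Iio t),
      ∀ y ∈ Submodule.span 𝕜 (e '' Set.Ici t), P n x ≤ 2 * P n (x + y) :=
    fun n t hnt x hx y hy => by
      refine hu n (J t) (hnt.trans (hJle t)) x (Submodule.span_mono ?_ hx) y
        (Submodule.span_mono ?_ hy)
      · rintro _ ⟨k, hk, rfl⟩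
        exact ⟨J k, hJ hk, rfl⟩
      · rintro _ ⟨k, hk, rfl⟩
        exact ⟨J k, hJ.monotone hk, rfl⟩
  obtain ⟨K, hKlim, hK, hKP⟩ := exists_perturbation_operator hP hPmono hψP
    (fun k => hψP (κ k)) (d := fun k => v (J k) - e k) (x := x) (fun s =>
      ((hPmono (hJle s) _).trans (hv (J s)).1).trans (by linarith [hhalf_anti (hJle s)]))
    (fun s => (hx s).1)
  let U : Submodule 𝕜 X := (Submodule.span 𝕜 (Set.range e)).topologicalClosure
  have heU : ∀ k, e k ∈ U := fun k =>
    Submodule.le_topologicalClosure _ (Submodule.subset_span ⟨k, rfl⟩)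
  obtain ⟨hclosed, hinj⟩ := isClosed_map_id_add hP (hPc 0) hP0 K hK hKP
    (U := U) (Submodule.isClosed_topologicalClosure _)
  refine ⟨U.map (LinearMap.id + K), hclosed,
    not_finiteDimensional_of_linearIndependent (e := fun k => (LinearMap.id + K : X →ₗ[𝕜] X) (e k))
      ((linearIndependent_of_biorthogonal hψe).map' _ (LinearMap.ker_eq_bot.2 hinj))
      (fun k => Submodule.mem_map_of_mem (heU k)), ?_⟩
  rintro _ ⟨w, hw, rfl⟩ hw0
  obtain ⟨htail, htail0⟩ := partialSum_properties hPc hψc hψe he hw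
  -- If all coordinates vanished, so would all partial sums, and their convergence to `w` would
  -- force w = 0.
  obtain ⟨k₀, hk₀⟩ : ∃ k, ψ k w ≠ 0 := by
    by_contra! hcon
    have h0 := htail0 0
    simp only [partialSum_apply, hcon, zero_smul, Finset.sum_const_zero, sub_zero] at h0
    have := hP0 w (tendsto_nhds_unique tendsto_const_nhds h0)
    exact hw0 (by rw [this, map_zero])
  have hzlim : Tendsto (fun N => w + ∑ s ∈ Finset.range N,
      (ψ s w • (v (J s) - e s) + ψ (κ s) w • x s)) atTop
      (𝓝 ((LinearMap.id + K : X →ₗ[𝕜] X) w)) := (hKlim w).const_add w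
  have htailM : ∀ s, w - partialSum e ψ s w ∈ M (J s) := fun s => by
    refine Submodule.topologicalClosure_minimal _ ?_ (hMclosed (J s)) (htail s)
    rw [Submodule.span_le]
    rintro _ ⟨k, hk, rfl⟩
    exact hManti (hJ.monotone hk) (huM (J k))
  have hmain : ∀ i, ∃ G : ℕ → ℝ, Tendsto G atTop (𝓝 0) ∧ ∀ᶠ s in atTop, κ s = k₀ →
      Q i (S (J s) ((LinearMap.id + K : X →ₗ[𝕜] X) w) - ψ k₀ w • y s) ≤ G s := by
    intro i
    obtain ⟨C, m, k, hC, hCM⟩ := hM i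
    refine ⟨fun s => C * P m (w - partialSum e ψ s w) + P 0 w * (2 * s + 4) * (1 / 2) ^ s,
      ?_, ?_⟩
    · have h1 := (htail0 m).const_mul C
      have h2 : Tendsto (fun s : ℕ => (s : ℝ) * (1 / 2) ^ s) atTop (𝓝 0) :=
        tendsto_self_mul_const_pow_of_lt_one (by norm_num) (by norm_num)
      have h3 : Tendsto (fun s : ℕ => ((1 : ℝ) / 2) ^ s) atTop (𝓝 0) :=
        tendsto_pow_atTop_nhds_zero_of_lt_one (by norm_num) (by norm_num)
      have h4 := h1.add ((h2.const_mul (2 * P 0 w)).add (h3.const_mul (4 * P 0 w)))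
      simp only [mul_zero, add_zero] at h4
      refine h4.congr fun s => ?_
      ring
    · filter_upwards [eventually_ge_atTop i, eventually_ge_atTop k] with s his hks hs
      have hlim : Tendsto (fun N => Q i (S (J s) (w + ∑ s ∈ Finset.range N,
          (ψ s w • (v (J s) - e s) + ψ (κ s) w • x s)) - ψ k₀ w • y s)) atTop (𝓝 (Q i (S (J s) ((LinearMap.id + K : X →ₗ[𝕜] X) w) - ψ k₀ w • y s))) :=
        ((hQc i).tendsto _).comp (((((S (J s)).continuous.tendsto _).comp hzlim)).sub_const _)
      refine le_of_tendsto hlim ?_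
      filter_upwards [eventually_ge_atTop (s + 1)] with N hN
      have h := seminorm_perturbed_sub_le (Q i) (S (J s)).toLinearMap (e := e)
        (v := fun k => v (J k)) (x := x) (a := fun k => ψ k w) (b := fun k => ψ (κ k) w)
        (R := P 0 w) (fun k => hψP k w) (fun k => hψP (κ k) w) (s := s) (y := y s)
        (fun k hk => (hQmono his _).trans ((hx s).2.2 k hk).1)
        (fun k hk => (hQmono his _).trans ((hx s).2.2 k hk).2.1)
        ((hQmono his _).trans (hx s).2.1)
        (fun k hk => (hQmono (his.trans (hk.trans (hJle k))) _).trans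
          (((hv (J k)).2 (J s) (hJ.monotone hk)).trans (hhalf_anti (hJle k))))
        (fun k hk => (hQmono (his.trans hk.le) _).trans ((hx k).2.2 s hk).2.2) w hN
      have h' := hCM (J s) (hks.trans (hJle s)) _ (htailM s)
      simp only [hs, ← partialSum_apply] at h
      exact h.trans (by gcongr; exact h')
  exact dense_of_approx hQ hk₀ (fun s => ⟨J s, rfl⟩) hmain

end

end HypercyclicSubspace

theorem theorem1p9 {𝕜 : Type*} [RCLike 𝕜]
    -- `X` is an infinite-dimensional Fréchet space with a continuous norm,
    -- and `p` is a sequence of seminorms defining its topology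
    {X : Type*} [AddCommGroup X] [Module 𝕜 X] [UniformSpace X] [IsUniformAddGroup X]
    [T2Space X] [CompleteSpace X] (p : SeminormFamily 𝕜 X ℕ) (hp : WithSeminorms p)
    (hXdim : ¬ FiniteDimensional 𝕜 X) (hXnorm : HasContinuousNorm 𝕜 X)
    -- `Y` is a separable Fréchet space, and `q` is a sequence of seminorms defining its topology
    {Y : Type*} [AddCommGroup Y] [Module 𝕜 Y] [UniformSpace Y] [IsUniformAddGroup Y]
    [T2Space Y] [CompleteSpace Y] [TopologicalSpace.SeparableSpace Y]
    (q : SeminormFamily 𝕜 Y ℕ) (hq : WithSeminorms q)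
    (T : ℕ → X →L[𝕜] Y) (n : ℕ → ℕ) (hC : SatisfiesConditionC T n)
    (M : ℕ → Submodule 𝕜 X) (hM_anti : Antitone M)
    (hM_closed : ∀ j, IsClosed (M j : Set X)) (hM_dim : ∀ j, ¬ FiniteDimensional 𝕜 (M j))
    (hM : ∀ i : ℕ, ∃ C : ℝ, 0 < C ∧ ∃ m k : ℕ, ∀ j, k ≤ j → ∀ x ∈ M j,
      q i (T (n j) x) ≤ C * p m x) :
    HasHypercyclicSubspace T := by
  obtain ⟨r, hr, hr0⟩ := hXnorm
  obtain ⟨-, X₀, hX₀, hT₀, hT⟩ := hC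
  choose C hC m k hCM using hM
  obtain ⟨U, hUc, hUd, hU⟩ := HypercyclicSubspace.exists_hypercyclic_subspace_of_monotone
    (HypercyclicSubspace.withSeminorms_sup_partialSups hp hr)
    (HypercyclicSubspace.monotone_partialSups_seminorm p r)
    (fun x hx => hr0 x (le_antisymm ((le_max_right _ _).trans hx.le) (apply_nonneg r x)))
    hq.partial_sups (fun i j hij => Finset.sup_mono (Finset.Iic_subset_Iic.2 hij))
    (S := fun j => T (n j)) hX₀ hT₀ hT hM_anti hM_closed hM_dim (fun i => by
      -- The bound for the i-th partial supremum of `q` combines those for a ≤ i: the sum of the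
      -- constants dominates each of them, and the suprema of `m` and `k` serve all a ≤ i.
      refine ⟨∑ a ∈ Finset.Iic i, C a, (Finset.Iic i).sup m, (Finset.Iic i).sup k,
        Finset.sum_nonneg fun a _ => (hC a).le, fun j hj x hx => ?_⟩
      refine Seminorm.finset_sup_apply_le
        (mul_nonneg (Finset.sum_nonneg fun a _ => (hC a).le) (apply_nonneg _ _)) fun a ha => ?_
      refine (hCM a j ((Finset.le_sup (f := k) ha).trans hj) x hx).trans ?_
      have h1 : C a ≤ ∑ a ∈ Finset.Iic i, C a :=
        Finset.single_le_sum (fun a _ => (hC a).le) ha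
      have h2 : p (m a) x ≤ ((Finset.Iic ((Finset.Iic i).sup m)).sup p ⊔ r) x :=
        (Seminorm.le_def.1 (Finset.le_sup (f := p)
          (Finset.mem_Iic.2 (Finset.le_sup (f := m) ha))) x).trans (le_max_left _ _)
      exact mul_le_mul h1 h2 (apply_nonneg _ _) ((hC a).le.trans h1))
  refine ⟨U, hUc, hUd, fun x hx hx0 => (hU x hx hx0).mono ?_⟩
  rintro _ ⟨j, rfl⟩
  exact ⟨n j, rfl⟩
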